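/- A \emph{continuum} is a compact connected Hausdorff space. A continuum $X$ is called \emph{Suslinian} if it contains no uncountable family of pairwise disjoint non-degenerate subcontinua (a subcontinuum is non-degenerate if it has more than one point). A \emph{tree} is a partially ordered set in which the set of strict predecessors of every node is well-ordered; the height of a node is the order type of this set, and the height of the tree is the least ordinal greater than the heights of all nodes. An \emph{$\aleph_1$-Suslin tree} is a tree of height $\omega_1$ that contains no chain and no antichain of cardinality $\aleph_1$. The \emph{Suslin Hypothesis} asserts that no $\aleph_1$-Suslin tree exists. \textbf{Corollary.} Under the Suslin Hypothesis, every Suslinian continuum is metrizable. -/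

import Mathlib

universe u

/-- A continuum `X` is Suslinian if every family of pairwise disjoint non-degenerate subcontinua
of `X` is countable. A subcontinuum of the compact Hausdorff space `X` is a closed connected
(in particular nonempty) subset; non-degenerate means having more than one point. -/
def IsSuslinian (X : Type u) [TopologicalSpace X] : Prop :=
  ∀ C : Set (Set X),
    (∀ K ∈ C, IsClosed K ∧ IsConnected K ∧ K.Nontrivial) →
    C.PairwiseDisjoint id → C.Countable

/-- A tree in the set-theoretic sense: a partially ordered set in which the strict
predecessors of each node are well-ordered. -/
structure IsOrderTree (T : Type u) [PartialOrder T] : Prop where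
  isWellOrder_Iio : ∀ t : T, IsWellOrder (Set.Iio t) (· < ·)

namespace IsOrderTree

variable {T : Type u} [PartialOrder T]

/-- The height of a node: the order type of the set of its strict predecessors. -/
noncomputable def nodeHeight (h : IsOrderTree T) (t : T) : Ordinal.{u} :=
  haveI := h.isWellOrder_Iio t
  Ordinal.type (fun a b : Set.Iio t => a < b)

/-- The height of a tree: the least ordinal greater than the heights of all its nodes. -/
noncomputable def height (h : IsOrderTree T) : Ordinal.{u} :=
  ⨆ t : T, Order.succ (h.nodeHeight t)

end IsOrderTree

/-- A `κ`-Suslin tree: a tree of height `κ` (cardinals being identified with initial ordinals)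
without chains or antichains of size `κ`. -/
structure IsSuslinTree (κ : Cardinal.{u}) (T : Type u) [PartialOrder T] : Prop where
  isOrderTree : IsOrderTree T
  height_eq : isOrderTree.height = κ.ord
  chain_lt : ∀ C : Set T, IsChain (· ≤ ·) C → Cardinal.mk C < κ
  antichain_lt : ∀ A : Set T, IsAntichain (· ≤ ·) A → Cardinal.mk A < κ

/-- The Suslin Hypothesis: there is no `ℵ₁`-Suslin tree. Such a tree has exactly `ℵ₁` nodes,
so trees in the lowest universe represent all of them. -/
def SuslinHypothesis : Prop :=
  ∀ (T : Type) [PartialOrder T], ¬ IsSuslinTree (Cardinal.aleph 1) T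

/-! A family of real functions on `X` has a joint map into a power of the line; consider the
non-degenerate components of its fibers. If the family is countable and there are none (a light
map), `X` is metrizable: over the closure of each basic open set lie only countably many
non-degenerate components, by the Suslinian property. Urysohn functions for disjoint pairs of these,
together with the family, separate points, since boundary bumping makes the relevant components
non-degenerate.

To reach a light map, adjoin transfinitely, for each surviving fiber component, a function not
constant on it. Stages below `ω₁` are countable families. If none is light, the components from all
these stages, under reverse inclusion, form a tree of height `ω₁`. Antichains are disjoint families
of continua, hence countable; chains are countable because the gaps between successive members
contain disjoint non-degenerate continua. This Suslin tree contradicts the hypothesis. -/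

open Set Topology
open Cardinal (aleph)

/-! ### Components of compact sets -/

section Components

variable {X : Type*} [TopologicalSpace X]

/-- A compact set can be split along the boundary of any neighbourhood of one of its components. -/
theorem IsCompact.exists_separation_of_connectedComponentIn_subset [T2Space X] {K W : Set X}
    (hK : IsCompact K) {x : X} (hx : x ∈ K) (hW : IsOpen W)
    (hKW : connectedComponentIn K x ⊆ W) :
    ∃ U V : Set X, IsOpen U ∧ IsOpen V ∧ Disjoint U V ∧ K ⊆ U ∪ V ∧ x ∈ U ∧ U ∩ K ⊆ W := by
  have : CompactSpace K := isCompact_iff_compactSpace.mp hK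
  have hsub : connectedComponent (⟨x, hx⟩ : K) ⊆ Subtype.val ⁻¹' W := by
    rw [connectedComponentIn_eq_image hx] at hKW
    exact image_subset_iff.mp hKW
  -- In a compact Hausdorff space components are quasi-components, so by compactness a single clopen
  -- `Q` already fits inside `W`.
  rw [connectedComponent_eq_iInter_isClopen] at hsub
  have : Nonempty { s : Set K // IsClopen s ∧ (⟨x, hx⟩ : K) ∈ s } :=
    ⟨⟨univ, isClopen_univ, mem_univ _⟩⟩
  obtain ⟨⟨Q, hQ, hxQ⟩, hQW⟩ := exists_subset_nhds_of_isCompact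
    (V := fun s : { s : Set K // IsClopen s ∧ (⟨x, hx⟩ : K) ∈ s } => s.1)
    (fun s t => ⟨⟨s.1 ∩ t.1, s.2.1.inter t.2.1, s.2.2, t.2.2⟩, inter_subset_left,
      inter_subset_right⟩)
    (fun s => s.2.1.isClosed.isCompact)
    (fun y hy => (hW.preimage continuous_subtype_val).mem_nhds (hsub hy))
  have hdis : Disjoint ((↑) '' Q : Set X) ((↑) '' Qᶜ) :=
    (disjoint_image_iff Subtype.val_injective).mpr disjoint_compl_right
  obtain ⟨U, V, hU, hV, hQU, hQV, hUV⟩ := SeparatedNhds.of_isCompact_isCompact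
    (hQ.isClosed.isCompact.image continuous_subtype_val)
    (hQ.compl.isClosed.isCompact.image continuous_subtype_val) hdis
  refine ⟨U, V, hU, hV, hUV, fun y hy => ?_, hQU ⟨_, hxQ, rfl⟩, fun y hy => ?_⟩
  · by_cases h : (⟨y, hy⟩ : K) ∈ Q
    · exact Or.inl (hQU ⟨_, h, rfl⟩)
    · exact Or.inr (hQV ⟨_, h, rfl⟩)
  · by_cases h : (⟨y, hy.2⟩ : K) ∈ Q
    · exact hQW h
    · exact absurd (hQV ⟨_, h, rfl⟩) (disjoint_left.mp hUV hy.1)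

theorem IsClosed.isClosed_connectedComponentIn {K : Set X} (hK : IsClosed K) (x : X) :
    IsClosed (connectedComponentIn K x) := by
  by_cases hx : x ∈ K
  · rw [connectedComponentIn_eq_image hx]
    exact hK.isClosedEmbedding_subtypeVal.isClosedMap _ isClosed_connectedComponent
  · rw [connectedComponentIn_eq_empty hx]
    exact isClosed_empty

/-- Boundary bumping: in a continuum, a component of a proper closed set which meets the interior
of that set is non-degenerate. -/
theorem nontrivial_connectedComponentIn_of_mem_interior [CompactSpace X] [T2Space X]
    [PreconnectedSpace X] {K : Set X} (hK : IsClosed K) (hne : K ≠ univ) {x : X}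
    (hx : x ∈ interior K) : (connectedComponentIn K x).Nontrivial := by
  have hxK := interior_subset hx
  by_contra hnt
  have hsub : connectedComponentIn K x ⊆ interior K := fun y hy => by
    rwa [not_nontrivial_iff.mp hnt hy (mem_connectedComponentIn hxK)]
  obtain ⟨U, V, hU, hV, hUV, hcov, hxU, hUK⟩ :=
    hK.isCompact.exists_separation_of_connectedComponentIn_subset hxK isOpen_interior hsub
  -- `U ∩ K` is open because it lies in the interior of `K`, and closed because it equals `K \ V`.
  have hopen : U ∩ K = U ∩ interior K :=
    subset_antisymm (subset_inter inter_subset_left hUK)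
      (inter_subset_inter_right _ interior_subset)
  have hclosed : U ∩ K = K \ V := by
    ext y
    refine ⟨fun h => ⟨h.2, disjoint_left.mp hUV h.1⟩, fun h => ⟨?_, h.1⟩⟩
    exact (hcov h.1).resolve_right h.2
  have hclopen : IsClopen (U ∩ K) :=
    ⟨hclosed ▸ hK.sdiff hV, hopen ▸ hU.inter isOpen_interior⟩
  have huniv := hclopen.eq_univ ⟨x, hxU, hxK⟩
  exact hne (univ_subset_iff.mp (huniv ▸ inter_subset_right))

/-- The difference of two nested continua contains a non-degenerate continuum. -/
theorem exists_continuum_subset_sdiff [T2Space X] {K L : Set X} (hK : IsCompact K)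
    (hKc : IsConnected K) (hL : IsClosed L) (hLne : L.Nonempty) (hLK : L ⊂ K) :
    ∃ M ⊆ K \ L, IsClosed M ∧ IsConnected M ∧ M.Nontrivial := by
  have : CompactSpace K := isCompact_iff_compactSpace.mp hK
  have : ConnectedSpace K := isConnected_iff_connectedSpace.mp hKc
  obtain ⟨x, hxK, hxL⟩ := exists_of_ssubset hLK
  obtain ⟨y, hyL⟩ := hLne
  have hL' : IsClosed ((↑) ⁻¹' L : Set K) := hL.preimage continuous_subtype_val
  -- Boundary bumping is applied inside `K` to a closed neighbourhood `N` of `x` missing `L`; it is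
  -- proper as `L` is nonempty.
  obtain ⟨N, hN, hNcl, hNL⟩ := exists_mem_nhds_isClosed_subset
    (hL'.isOpen_compl.mem_nhds (show (⟨x, hxK⟩ : K) ∈ ((↑) ⁻¹' L : Set K)ᶜ from hxL))
  have hNne : N ≠ univ := fun h => hNL (h ▸ mem_univ (⟨y, hLK.1 hyL⟩ : K)) hyL
  have hxN := mem_interior_iff_mem_nhds.mpr hN
  refine ⟨(↑) '' connectedComponentIn N (⟨x, hxK⟩ : K), ?_, ?_, ?_, ?_⟩
  · rintro _ ⟨z, hz, rfl⟩
    exact ⟨z.2, hNL (connectedComponentIn_subset _ _ hz)⟩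
  · exact ((hNcl.isClosed_connectedComponentIn _).isCompact.image
      continuous_subtype_val).isClosed
  · exact (isConnected_connectedComponentIn_iff.mpr (interior_subset hxN)).image _
      continuous_subtype_val.continuousOn
  · exact (nontrivial_connectedComponentIn_of_mem_interior hNcl hNne hxN).image
      Subtype.val_injective

end Components

/-! ### Fibers of families of continuous functions -/

section Fibers

variable {X : Type u} [TopologicalSpace X]

/-- The non-degenerate components of a set. -/
def nontrivialComponents (K : Set X) : Set (Set X) :=
  {C | C.Nontrivial ∧ ∃ x, C = connectedComponentIn K x}

theorem nontrivialComponents_pairwiseDisjoint (K : Set X) :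
    (nontrivialComponents K).PairwiseDisjoint id := by
  rintro _ ⟨-, x, rfl⟩ _ ⟨-, y, rfl⟩ hne
  refine disjoint_left.mpr fun z hzx hzy => hne ?_
  rw [connectedComponentIn_eq hzx, connectedComponentIn_eq hzy]

theorem IsSuslinian.countable_nontrivialComponents (hX : IsSuslinian X) {K : Set X}
    (hK : IsClosed K) : (nontrivialComponents K).Countable := by
  refine hX _ ?_ (nontrivialComponents_pairwiseDisjoint K)
  rintro _ ⟨hn, x, rfl⟩
  exact ⟨hK.isClosed_connectedComponentIn x,
    ⟨hn.nonempty, isPreconnected_connectedComponentIn⟩, hn⟩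

/-- The fiber through `x` of the joint map defined by a family of functions. -/
def commonFiber (F : Set C(X, ℝ)) (x : X) : Set X :=
  {y | ∀ f ∈ F, f y = f x}

theorem mem_commonFiber_self (F : Set C(X, ℝ)) (x : X) : x ∈ commonFiber F x :=
  fun _ _ => rfl

theorem isClosed_commonFiber (F : Set C(X, ℝ)) (x : X) : IsClosed (commonFiber F x) := by
  simp only [commonFiber, ofPred_forall]
  exact isClosed_biInter fun f _ => isClosed_eq f.continuous continuous_const

theorem commonFiber_eq_of_mem {F : Set C(X, ℝ)} {x y : X} (h : y ∈ commonFiber F x) :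
    commonFiber F y = commonFiber F x := by
  ext z
  exact forall₂_congr fun f hf => by rw [h f hf]

theorem commonFiber_anti {F G : Set C(X, ℝ)} (h : F ⊆ G) (x : X) :
    commonFiber G x ⊆ commonFiber F x :=
  fun _ hy f hf => hy f (h hf)

/-- The non-degenerate components of the fibers of the joint map defined by a family of
functions. -/
def fiberContinua (F : Set C(X, ℝ)) : Set (Set X) :=
  {K | K.Nontrivial ∧ ∃ x, K = connectedComponentIn (commonFiber F x) x}

theorem eq_connectedComponentIn_of_mem_fiberContinua {F : Set C(X, ℝ)} {K : Set X}
    (hK : K ∈ fiberContinua F) {x : X} (hx : x ∈ K) :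
    K = connectedComponentIn (commonFiber F x) x := by
  obtain ⟨-, y, rfl⟩ := hK
  rw [commonFiber_eq_of_mem (connectedComponentIn_subset _ _ hx), ← connectedComponentIn_eq hx]

theorem isClosed_of_mem_fiberContinua {F : Set C(X, ℝ)} {K : Set X} (hK : K ∈ fiberContinua F) :
    IsClosed K := by
  obtain ⟨-, x, rfl⟩ := hK
  exact (isClosed_commonFiber F x).isClosed_connectedComponentIn x

theorem isConnected_of_mem_fiberContinua {F : Set C(X, ℝ)} {K : Set X}
    (hK : K ∈ fiberContinua F) : IsConnected K := by
  obtain ⟨hn, x, rfl⟩ := hK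
  exact ⟨hn.nonempty, isPreconnected_connectedComponentIn⟩

/-- At a common point both sets are components of fibers through it, and more functions give smaller
fibers. Hence continua of nested families are nested or disjoint, which yields the tree order. -/
theorem fiberContinua_subset_of_inter_nonempty {F G : Set C(X, ℝ)} (h : F ⊆ G) {K L : Set X}
    (hK : K ∈ fiberContinua F) (hL : L ∈ fiberContinua G) (hKL : (K ∩ L).Nonempty) : L ⊆ K := by
  obtain ⟨x, hxK, hxL⟩ := hKL
  rw [eq_connectedComponentIn_of_mem_fiberContinua hK hxK,
    eq_connectedComponentIn_of_mem_fiberContinua hL hxL]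
  exact connectedComponentIn_mono x (commonFiber_anti h x)

theorem exists_mem_fiberContinua_superset {F G : Set C(X, ℝ)} (h : F ⊆ G) {L : Set X}
    (hL : L ∈ fiberContinua G) : ∃ K ∈ fiberContinua F, L ⊆ K := by
  obtain ⟨hn, x, rfl⟩ := hL
  have hsub := connectedComponentIn_mono x (commonFiber_anti h x)
  exact ⟨_, ⟨hn.mono hsub, x, rfl⟩, hsub⟩

theorem IsSuslinian.countable_fiberContinua (hX : IsSuslinian X) (F : Set C(X, ℝ)) :
    (fiberContinua F).Countable := by
  refine hX _ (fun K hK => ⟨isClosed_of_mem_fiberContinua hK,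
    isConnected_of_mem_fiberContinua hK, hK.1⟩) fun K hK L hL hne => ?_
  by_contra hd
  have hi : (K ∩ L).Nonempty := not_disjoint_iff_nonempty_inter.mp hd
  exact hne (subset_antisymm
    (fiberContinua_subset_of_inter_nonempty subset_rfl hL hK (inter_comm K L ▸ hi))
    (fiberContinua_subset_of_inter_nonempty subset_rfl hK hL hi))

end Fibers

/-! ### Light maps -/

/-- The joint map is a continuous injection of a compact space into a metrizable one, hence an
embedding. -/
theorem metrizableSpace_of_countable_separating {X : Type*} [TopologicalSpace X]
    [CompactSpace X] {F : Set C(X, ℝ)} (hF : F.Countable)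
    (hsep : ∀ x y : X, (∀ f ∈ F, f x = f y) → x = y) : TopologicalSpace.MetrizableSpace X := by
  have : Countable F := hF
  have hcont : Continuous fun (x : X) (f : F) => f.1 x := by fun_prop
  have hinj : Function.Injective fun (x : X) (f : F) => f.1 x := fun x y h =>
    hsep x y fun f hf => congrFun h ⟨f, hf⟩
  have : TopologicalSpace.MetrizableSpace (F → ℝ) :=
    TopologicalSpace.metrizableSpace_of_t3_secondCountable _
  exact (hcont.isClosedEmbedding hinj).isEmbedding.metrizableSpace

section Light

variable {X : Type u} [TopologicalSpace X] [CompactSpace X] [T2Space X]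

/-- Points in different components of a fiber lie in different components of the preimage of a
small closed neighbourhood. -/
theorem exists_nhds_notMem_connectedComponentIn_preimage {Y : Type*} [TopologicalSpace Y]
    [T2Space Y] {g : X → Y} (hg : Continuous g) {x y : X} (hxy : g y = g x)
    (h : y ∉ connectedComponentIn (g ⁻¹' {g x}) x) :
    ∃ N ∈ 𝓝 (g x), ∀ B ⊆ N, g x ∈ B → y ∉ connectedComponentIn (g ⁻¹' B) x := by
  have hcl : IsClosed (g ⁻¹' {g x}) := isClosed_singleton.preimage hg
  obtain ⟨U, V, hU, hV, hUV, hcov, hxU, hUy⟩ :=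
    hcl.isCompact.exists_separation_of_connectedComponentIn_subset (x := x) rfl
      (isOpen_compl_singleton (x := y)) (fun z hz hzy => h (hzy ▸ hz))
  have hyV : y ∈ V := (hcov hxy).resolve_left fun hyU => hUy ⟨hyU, hxy⟩ rfl
  -- Off this closed image, which misses `g x`, all preimages lie in `U ∪ V`; a connected set there
  -- meeting `U` avoids `V`.
  have hC : IsClosed (g '' (U ∪ V)ᶜ) :=
    ((hU.union hV).isClosed_compl.isCompact.image hg).isClosed
  refine ⟨(g '' (U ∪ V)ᶜ)ᶜ, hC.isOpen_compl.mem_nhds ?_, fun B hB hxB hy => ?_⟩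
  · rintro ⟨z, hz, hzx⟩
    exact hz (hcov hzx)
  · have hsub : connectedComponentIn (g ⁻¹' B) x ⊆ U ∪ V := fun z hz => by
      by_contra hzn
      exact hB (connectedComponentIn_subset (g ⁻¹' B) x hz) ⟨z, hzn, rfl⟩
    have := isPreconnected_connectedComponentIn.subset_left_of_subset_union hU hV hUV hsub
      ⟨x, mem_connectedComponentIn hxB, hxU⟩
    exact disjoint_left.mp hUV (this hy) hyV

/-- A Suslinian continuum admitting a light map into a countable power of the line is
metrizable. -/
theorem IsSuslinian.metrizableSpace_of_light [ConnectedSpace X] (hX : IsSuslinian X)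
    {F : Set C(X, ℝ)} (hF : F.Countable) (hlight : fiberContinua F = ∅) :
    TopologicalSpace.MetrizableSpace X := by
  have : Countable F := hF
  let g : X → F → ℝ := fun x f => f.1 x
  have hg : Continuous g := by fun_prop
  have hfib : ∀ x, g ⁻¹' {g x} = commonFiber F x := fun x => by
    ext y
    simp only [mem_preimage, mem_singleton_iff, commonFiber, mem_ofPred_eq, g, funext_iff,
      Subtype.forall]
  let 𝓑 := TopologicalSpace.countableBasis (F → ℝ)
  let 𝓒 : Set (F → ℝ) → Set (Set X) := fun B => nontrivialComponents (g ⁻¹' closure B)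
  have hcl : ∀ B, IsClosed (g ⁻¹' closure B) := fun B => isClosed_closure.preimage hg
  -- The value 0 on unsuitable pairs lets `u` be defined on all pairs of sets.
  have hsep : ∀ p : Set X × Set X, ∃ f : C(X, ℝ), IsClosed p.1 → IsClosed p.2 →
      Disjoint p.1 p.2 → EqOn f 0 p.1 ∧ EqOn f 1 p.2 := fun p => by
    by_cases hp : IsClosed p.1 ∧ IsClosed p.2 ∧ Disjoint p.1 p.2
    · obtain ⟨f, h0, h1, -⟩ := exists_continuous_zero_one_of_isClosed hp.1 hp.2.1 hp.2.2
      exact ⟨f, fun _ _ _ => ⟨h0, h1⟩⟩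
    · exact ⟨0, fun h1 h2 h3 => absurd ⟨h1, h2, h3⟩ hp⟩
  choose u hu using hsep
  have hcount : (⋃ B ∈ 𝓑, u '' (𝓒 B ×ˢ 𝓒 B)).Countable :=
    (TopologicalSpace.countable_countableBasis _).biUnion fun B _ =>
      ((hX.countable_nontrivialComponents (hcl B)).prod
        (hX.countable_nontrivialComponents (hcl B))).image u
  refine metrizableSpace_of_countable_separating (hF.union hcount) fun x y hxy => ?_
  by_contra hne
  have hgxy : g y = g x := funext fun f => (hxy f.1 (Or.inl f.2)).symm
  have hnot : y ∉ connectedComponentIn (g ⁻¹' {g x}) x := fun hy => by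
    rw [hfib] at hy
    have : connectedComponentIn (commonFiber F x) x ∈ fiberContinua F :=
      ⟨⟨x, mem_connectedComponentIn (mem_commonFiber_self F x), y, hy, hne⟩, x, rfl⟩
    rw [hlight] at this
    exact this
  obtain ⟨N, hN, hNy⟩ := exists_nhds_notMem_connectedComponentIn_preimage hg hgxy hnot
  obtain ⟨M, hM, hMcl, hMN⟩ := exists_mem_nhds_isClosed_subset hN
  obtain ⟨B, hB, hxB, hBM⟩ :=
    (TopologicalSpace.isBasis_countableBasis (F → ℝ)).mem_nhds_iff.mp hM
  have hy := hNy (closure B) ((hMcl.closure_subset_iff.mpr hBM).trans hMN) (subset_closure hxB)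
  have hBopen : IsOpen B := TopologicalSpace.isOpen_of_mem_countableBasis hB
  have hint : ∀ z, g z = g x → z ∈ interior (g ⁻¹' closure B) := fun z hz =>
    interior_maximal (preimage_mono subset_closure) (hBopen.preimage hg)
      (show g z ∈ B from hz ▸ hxB)
  have hxK := interior_subset (hint x rfl)
  have hyK := interior_subset (hint y hgxy)
  -- Otherwise connectedness of `X` would put `y` in the component of `x`.
  have hproper : g ⁻¹' closure B ≠ univ := fun h => hy <| by
    rw [h, connectedComponentIn_univ, PreconnectedSpace.connectedComponent_eq_univ]
    trivial
  have hCx : connectedComponentIn (g ⁻¹' closure B) x ∈ 𝓒 B :=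
    ⟨nontrivial_connectedComponentIn_of_mem_interior (hcl B) hproper (hint x rfl), x, rfl⟩
  have hCy : connectedComponentIn (g ⁻¹' closure B) y ∈ 𝓒 B :=
    ⟨nontrivial_connectedComponentIn_of_mem_interior (hcl B) hproper (hint y hgxy), y, rfl⟩
  have hdis : Disjoint (connectedComponentIn (g ⁻¹' closure B) x)
      (connectedComponentIn (g ⁻¹' closure B) y) :=
    nontrivialComponents_pairwiseDisjoint _ hCx hCy fun h =>
      hy (h ▸ mem_connectedComponentIn hyK)
  obtain ⟨h0, h1⟩ := hu (connectedComponentIn (g ⁻¹' closure B) x,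
    connectedComponentIn (g ⁻¹' closure B) y) ((hcl B).isClosed_connectedComponentIn x)
    ((hcl B).isClosed_connectedComponentIn y) hdis
  have huxy := hxy _ (Or.inr (mem_biUnion hB ⟨_, mk_mem_prod hCx hCy, rfl⟩))
  rw [h0 (mem_connectedComponentIn hxK), h1 (mem_connectedComponentIn hyK)] at huxy
  exact zero_ne_one huxy

end Light

/-! ### Trees with a level function -/

section Levels

/-- `ℓ` restricts to an order isomorphism from the predecessors of `t` onto the ordinals below `ℓ
t`, so it is the height function. -/
theorem isSuslinTree_of_levels {T : Type} [PartialOrder T] (ℓ : T → Ordinal.{0})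
    (hmono : StrictMono ℓ) (hlin : ∀ t a b : T, a < t → b < t → a ≤ b ∨ b ≤ a)
    (hpred : ∀ t : T, ∀ α < ℓ t, ∃ s < t, ℓ s = α)
    (hrange : ∀ α, (∃ t, ℓ t = α) ↔ α < (aleph 1).ord)
    (hchain : ∀ C : Set T, IsChain (· ≤ ·) C → C.Countable)
    (hanti : ∀ A : Set T, IsAntichain (· ≤ ·) A → A.Countable) :
    IsSuslinTree (aleph 1) T := by
  have hiso : ∀ t : T, Nonempty
      ((fun a b : Iio t => a < b) ≃r (fun a b : (ℓ t).ToType => a < b)) := fun t => by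
    let e : Iio t → Iio (ℓ t) := fun a => ⟨ℓ a, hmono a.2⟩
    have hlt : ∀ a b : Iio t, e a < e b ↔ a < b := fun a b => by
      refine ⟨fun h => ?_, fun h => hmono h⟩
      have h' : ℓ a < ℓ b := h
      rcases hlin t a b a.2 b.2 with hab | hab
      · exact lt_of_le_of_ne hab fun heq => h'.ne (congrArg ℓ (congrArg Subtype.val heq))
      · exact absurd h' (hmono.monotone hab).not_gt
    have hinj : Function.Injective e := fun a b hab => by
      have h' : ℓ a = ℓ b := congrArg Subtype.val hab
      refine Subtype.ext ?_
      rcases hlin t a b a.2 b.2 with h | h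
      · exact h.eq_or_lt.resolve_right fun hl => (hmono hl).ne h'
      · exact (h.eq_or_lt.resolve_right fun hl => (hmono hl).ne h'.symm).symm
    have hsurj : Function.Surjective e := fun ⟨α, hα⟩ => by
      obtain ⟨s, hs, rfl⟩ := hpred t α hα
      exact ⟨⟨s, hs⟩, rfl⟩
    exact ⟨RelIso.trans ⟨Equiv.ofBijective e ⟨hinj, hsurj⟩, fun {a b} => hlt a b⟩
      Ordinal.ToType.mk.toRelIsoLT⟩
  have htree : IsOrderTree T := ⟨fun t => (hiso t).some.toRelEmbedding.isWellOrder⟩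
  have hheight : ∀ t, htree.nodeHeight t = ℓ t := fun t => by
    have := htree.isWellOrder_Iio t
    unfold IsOrderTree.nodeHeight
    rw [(Ordinal.type_eq).mpr (hiso t), Ordinal.type_toType]
  have hcard : ∀ {S : Set T}, S.Countable → Cardinal.mk S < aleph 1 := fun hS =>
    Cardinal.lt_aleph_one_iff.mpr (Cardinal.le_aleph0_iff_set_countable.mpr hS)
  refine ⟨htree, ?_, fun C hC => hcard (hchain C hC),
    fun A hA => hcard (hanti A hA)⟩
  unfold IsOrderTree.height
  simp only [hheight]
  refine le_antisymm (Ordinal.iSup_le fun t => Order.succ_le_of_lt ((hrange _).mp ⟨t, rfl⟩)) ?_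
  refine le_of_forall_lt fun α hα => ?_
  obtain ⟨t, rfl⟩ := (hrange α).mpr hα
  exact (Order.lt_succ (ℓ t)).trans_le (Ordinal.le_iSup (fun t => Order.succ (ℓ t)) t)

end Levels

/-! ### The tree of fiber continua -/

section FiberTree

variable {X : Type u} [TopologicalSpace X]

/-- The transfinite sequence of families of functions which at each stage separates points of
every non-degenerate fiber component of all previous stages, where `c K` is a function chosen
for the continuum `K`. -/
noncomputable def separatingFamily (c : Set X → C(X, ℝ)) (α : Ordinal.{0}) : Set C(X, ℝ) :=
  ⋃ β : Iio α, c '' fiberContinua (separatingFamily c β.1)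
termination_by α
decreasing_by exact β.2

theorem mem_separatingFamily {c : Set X → C(X, ℝ)} {α : Ordinal.{0}} {f : C(X, ℝ)} :
    f ∈ separatingFamily c α ↔ ∃ β < α, ∃ K ∈ fiberContinua (separatingFamily c β), c K = f := by
  rw [separatingFamily]
  simp only [mem_iUnion, mem_image, Subtype.exists, mem_Iio, exists_prop]

theorem separatingFamily_mono (c : Set X → C(X, ℝ)) : Monotone (separatingFamily c) := by
  intro α β h f hf
  obtain ⟨γ, hγ, hK⟩ := mem_separatingFamily.mp hf
  exact mem_separatingFamily.mpr ⟨γ, hγ.trans_le h, hK⟩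

theorem countable_Iio_of_lt_ord_aleph_one {α : Ordinal.{0}} (hα : α < (aleph 1).ord) :
    Countable (Iio α) := by
  rw [← Cardinal.mk_le_aleph0_iff, Cardinal.mk_Iio_ordinal, Cardinal.lift_le_aleph0,
    ← Cardinal.lt_aleph_one_iff]
  exact Cardinal.lt_ord.mp hα

theorem IsSuslinian.countable_separatingFamily (hX : IsSuslinian X) (c : Set X → C(X, ℝ))
    {α : Ordinal.{0}} (hα : α < (aleph 1).ord) : (separatingFamily c α).Countable := by
  have := countable_Iio_of_lt_ord_aleph_one hα
  rw [separatingFamily]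
  exact countable_iUnion fun β => (hX.countable_fiberContinua _).image c

/-- If `c K` is never constant on `K`, distinct stages have no common fiber components. -/
theorem notMem_fiberContinua_of_lt {c : Set X → C(X, ℝ)}
    (hc : ∀ K : Set X, K.Nontrivial → ∃ x ∈ K, ∃ y ∈ K, c K x ≠ c K y) {α β : Ordinal.{0}}
    (h : α < β) {K L : Set X} (hK : K ∈ fiberContinua (separatingFamily c α))
    (hL : L ∈ fiberContinua (separatingFamily c β)) : ¬ K ⊆ L := by
  intro hKL
  -- `c K` belongs to the family of stage `β`, so it is constant on `L`.
  obtain ⟨x, hx, y, hy, hne⟩ := hc K hK.1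
  rw [eq_connectedComponentIn_of_mem_fiberContinua hL (hKL hx)] at hKL
  exact hne (connectedComponentIn_subset _ _ (hKL hy) (c K)
    (mem_separatingFamily.mpr ⟨α, h, K, hK, rfl⟩)).symm

/-- A nested family of continua which is well-founded from above is countable in a Suslinian
space. -/
theorem IsSuslinian.countable_of_isChain [CompactSpace X] [T2Space X] (hX : IsSuslinian X)
    {C : Set (Set X)} (hC : ∀ K ∈ C, IsClosed K ∧ IsConnected K) (hchain : IsChain (· ⊆ ·) C)
    (ℓ : Set X → Ordinal.{0}) (hℓ : ∀ K ∈ C, ∀ L ∈ C, L ⊂ K → ℓ K < ℓ L) : C.Countable := by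
  let D : Set (Set X) := {K ∈ C | ∃ L ∈ C, L ⊂ K}
  -- Minimizing `ℓ` among the members strictly inside `K` gives the largest of them, `s K`. The gaps
  -- `K \ s K` are pairwise disjoint.
  have hnext : ∀ K : D, ∃ L ∈ C, L ⊂ K.1 ∧ ∀ M ∈ C, M ⊂ K.1 → M ⊆ L := fun K => by
    have hne : {L ∈ C | L ⊂ K.1}.Nonempty := K.2.2
    obtain ⟨L, hL, hmin⟩ := WellFounded.has_min (InvImage.wf ℓ Ordinal.lt_wf) _ hne
    refine ⟨L, hL.1, hL.2, fun M hM hMK => ?_⟩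
    by_contra hn
    have hLM : L ⊂ M := ⟨(hchain.total hM hL.1).resolve_left hn, hn⟩
    exact hmin M ⟨hM, hMK⟩ (hℓ M hM L hL.1 hLM)
  choose s hsC hsK hs using hnext
  have hpiece : ∀ K : D, ∃ M ⊆ K.1 \ s K, IsClosed M ∧ IsConnected M ∧ M.Nontrivial := fun K =>
    exists_continuum_subset_sdiff (hC _ K.2.1).1.isCompact (hC _ K.2.1).2 (hC _ (hsC K)).1
      (hC _ (hsC K)).2.nonempty (hsK K)
  choose m hm hmc using hpiece
  have hdis' : ∀ K L : D, L.1 ⊂ K.1 → Disjoint (m K) (m L) := fun K L hLK =>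
    disjoint_left.mpr fun x hxK hxL => (hm K hxK).2 (hs K L L.2.1 hLK (hm L hxL).1)
  have hdis : ∀ K L : D, K ≠ L → Disjoint (m K) (m L) := fun K L hne => by
    have hne' : K.1 ≠ L.1 := fun h => hne (Subtype.ext h)
    rcases hchain.total K.2.1 L.2.1 with h | h
    · exact (hdis' L K (h.ssubset_of_ne hne')).symm
    · exact hdis' K L (h.ssubset_of_ne hne'.symm)
  have hinj : Function.Injective m := fun K L h => by
    by_contra hne
    have := hdis K L hne
    rw [h, disjoint_self] at this
    exact (hmc L).2.2.nonempty.ne_empty this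
  have hcount : (range m).Countable := by
    refine hX _ (by rintro _ ⟨K, rfl⟩; exact hmc K) ?_
    rintro _ ⟨K, rfl⟩ _ ⟨L, rfl⟩ hne
    exact hdis K L fun h => hne (h ▸ rfl)
  have hD : D.Countable := by
    have := hcount.to_subtype
    exact (rangeFactorization_injective.mpr hinj).countable
  have hrest : (C \ D).Subsingleton := fun K hK L hL => by
    by_contra hne
    rcases hchain.total hK.1 hL.1 with h | h
    · exact hL.2 ⟨hL.1, K, hK.1, h.ssubset_of_ne hne⟩
    · exact hK.2 ⟨hK.1, L, hL.1, h.ssubset_of_ne (Ne.symm hne)⟩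
  exact (hD.union hrest.countable).mono fun K hK => by
    by_cases h : K ∈ D
    · exact Or.inl h
    · exact Or.inr ⟨hK, h⟩

/-- If no countable stage of the construction yields a light map, the fiber components of all
countable stages form a Suslin tree. -/
theorem IsSuslinian.exists_isSuslinTree [CompactSpace X] [T2Space X] (hX : IsSuslinian X)
    {c : Set X → C(X, ℝ)} (hc : ∀ K : Set X, K.Nontrivial → ∃ x ∈ K, ∃ y ∈ K, c K x ≠ c K y)
    (hne : ∀ α < (aleph 1).ord, (fiberContinua (separatingFamily c α)).Nonempty) :
    ∃ (T : Type) (_ : PartialOrder T), IsSuslinTree (aleph 1) T := by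
  let lev : Ordinal.{0} → Set (Set X) := fun α => fiberContinua (separatingFamily c α)
  let N : Set (Set X) := ⋃ α : Iio (aleph 1).ord, lev α.1
  -- The tree must live in `Type`, while `X` is in an arbitrary universe; countability of the levels
  -- makes the set of nodes small.
  have : ∀ α : Iio (aleph 1).ord, Small.{0} (lev α.1) := fun α =>
    have : Countable (lev α.1) := hX.countable_fiberContinua _
    Countable.toSmall _
  have : Small.{0} N := small_iUnion _
  let v : Shrink.{0} N → Set X := fun t => ((equivShrink N).symm t : Set X)
  have hvinj : Function.Injective v := fun s t h =>
    (equivShrink N).symm.injective (Subtype.ext h)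
  have hvsurj : ∀ α < (aleph 1).ord, ∀ K ∈ lev α, ∃ t, v t = K := fun α hα K hK =>
    ⟨equivShrink N ⟨K, mem_iUnion.mpr ⟨⟨α, hα⟩, hK⟩⟩, by simp [v]⟩
  have hvlev : ∀ t, ∃ α < (aleph 1).ord, v t ∈ lev α := fun t => by
    obtain ⟨α, hα⟩ := mem_iUnion.mp ((equivShrink N).symm t).2
    exact ⟨α.1, α.2, hα⟩
  choose ℓ hℓlt hℓ using hvlev
  have hℓmono : ∀ s t, v t ⊂ v s → ℓ s < ℓ t := fun s t h => by
    by_contra hle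
    have hn : (v t ∩ v s).Nonempty := by
      rw [inter_eq_left.mpr h.1]
      exact (hℓ t).1.nonempty
    exact h.2 (fiberContinua_subset_of_inter_nonempty
      (separatingFamily_mono c (not_lt.mp hle)) (hℓ t) (hℓ s) hn)
  have hnested : ∀ s t, (v s ∩ v t).Nonempty → v s ⊆ v t ∨ v t ⊆ v s := fun s t h => by
    rcases le_total (ℓ s) (ℓ t) with hle | hle
    · exact Or.inr (fiberContinua_subset_of_inter_nonempty
        (separatingFamily_mono c hle) (hℓ s) (hℓ t) h)
    · exact Or.inl (fiberContinua_subset_of_inter_nonempty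
        (separatingFamily_mono c hle) (hℓ t) (hℓ s) (inter_comm (v s) (v t) ▸ h))
  have hℓuniq : ∀ t α, v t ∈ lev α → ℓ t = α := fun t α h => by
    rcases lt_trichotomy (ℓ t) α with hlt | heq | hlt
    · exact absurd subset_rfl (notMem_fiberContinua_of_lt hc hlt (hℓ t) h)
    · exact heq
    · exact absurd subset_rfl (notMem_fiberContinua_of_lt hc hlt h (hℓ t))
  -- Reverse inclusion: smaller continua are higher in the tree.
  let _ : PartialOrder (Shrink.{0} N) :=
    PartialOrder.lift (fun t => OrderDual.toDual (v t)) fun s t h => hvinj h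
  refine ⟨Shrink.{0} N, inferInstance, isSuslinTree_of_levels ℓ
    (fun s t h => hℓmono s t h) ?_ ?_ ?_ ?_ ?_⟩
  · intro t a b ha hb
    obtain ⟨x, hx⟩ := (hℓ t).1.nonempty
    exact (hnested b a ⟨x, hb.1 hx, ha.1 hx⟩)
  · intro t α hα
    obtain ⟨K, hK, htK⟩ :=
      exists_mem_fiberContinua_superset (separatingFamily_mono c hα.le) (hℓ t)
    obtain ⟨s, rfl⟩ := hvsurj α (hα.trans (hℓlt t)) K hK
    exact ⟨s, ⟨htK, notMem_fiberContinua_of_lt hc hα hK (hℓ t)⟩, hℓuniq s α hK⟩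
  · intro α
    refine ⟨?_, fun hα => ?_⟩
    · rintro ⟨t, rfl⟩
      exact hℓlt t
    · obtain ⟨K, hK⟩ := hne α hα
      obtain ⟨t, rfl⟩ := hvsurj α hα K hK
      exact ⟨t, hℓuniq t α hK⟩
  · intro C hC
    -- Each fiber of `v` over a node's continuum is a singleton, so the supremum merely transfers
    -- `ℓ` from nodes to sets.
    refine countable_of_injective_of_countable_image hvinj.injOn
      (hX.countable_of_isChain ?_ ?_ (fun K => sSup (ℓ '' (v ⁻¹' {K}))) ?_)
    · rintro _ ⟨t, -, rfl⟩
      exact ⟨isClosed_of_mem_fiberContinua (hℓ t), isConnected_of_mem_fiberContinua (hℓ t)⟩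
    · rintro _ ⟨s, hs, rfl⟩ _ ⟨t, ht, rfl⟩ -
      exact (hC.total hs ht).symm
    · have hval : ∀ t, sSup (ℓ '' (v ⁻¹' {v t})) = ℓ t := fun t => by
        have : v ⁻¹' {v t} = {t} := by
          ext s
          exact hvinj.eq_iff
        rw [this, image_singleton, csSup_singleton]
      rintro _ ⟨s, -, rfl⟩ _ ⟨t, -, rfl⟩ h
      simp only [hval]
      exact hℓmono s t h
  · intro A hA
    refine countable_of_injective_of_countable_image hvinj.injOn (hX _ ?_ ?_)
    · rintro _ ⟨t, -, rfl⟩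
      exact ⟨isClosed_of_mem_fiberContinua (hℓ t), isConnected_of_mem_fiberContinua (hℓ t),
        (hℓ t).1⟩
    · rintro _ ⟨s, hs, rfl⟩ _ ⟨t, ht, rfl⟩ hst
      by_contra hd
      have hne' : s ≠ t := fun h => hst (h ▸ rfl)
      rcases hnested s t (not_disjoint_iff_nonempty_inter.mp hd) with h | h
      · exact hA ht hs hne'.symm h
      · exact hA hs ht hne' h

end FiberTree

/-- Keeping nontriviality inside the existential lets `choose` produce a function `c` defined on all
sets. -/
theorem exists_continuousMap_ne_of_nontrivial {X : Type*} [TopologicalSpace X] [CompactSpace X]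
    [T2Space X] (K : Set X) :
    ∃ f : C(X, ℝ), K.Nontrivial → ∃ x ∈ K, ∃ y ∈ K, f x ≠ f y := by
  by_cases hK : K.Nontrivial
  · obtain ⟨x, hx, y, hy, hne⟩ := hK
    obtain ⟨f, h0, h1, -⟩ := exists_continuous_zero_one_of_isClosed (isClosed_singleton (x := x))
      (isClosed_singleton (x := y)) (disjoint_singleton.mpr hne)
    refine ⟨f, fun _ => ⟨x, hx, y, hy, ?_⟩⟩
    rw [h0 rfl, h1 rfl]
    exact zero_ne_one
  · exact ⟨0, fun h => absurd h hK⟩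

theorem mainTheorem7 (hSH : SuslinHypothesis) (X : Type u) [TopologicalSpace X]
    [CompactSpace X] [T2Space X] [ConnectedSpace X] (hX : IsSuslinian X) :
    TopologicalSpace.MetrizableSpace X := by
  choose c hc using exists_continuousMap_ne_of_nontrivial (X := X)
  by_contra hmet
  obtain ⟨T, _, hT⟩ := hX.exists_isSuslinTree hc fun α hα => by
    by_contra hempty
    exact hmet (hX.metrizableSpace_of_light (hX.countable_separatingFamily c hα)
      (not_nonempty_iff_eq_empty.mp hempty))
  exact hSH T hT
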